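/- Let $K$ be a number field with algebraic closure $\overline{K}$, let $f(z)\in K[z]$ be a monic polynomial of degree $d$, and let $(P_n)_{n\ge 0}$ be a sequence in $\overline{K}$ with $f(P_{n+1})=P_n$ for all $n\ge 0$. Suppose that there is a prime $\mathfrak{p}$ of $K$, lying above a rational prime $p\nmid d$, such that (i) $f$ has good reduction at $\mathfrak{p}$, i.e. every coefficient $a$ of $f$ satisfies $|a|_{\mathfrak{p}}\le 1$; and (ii) $P_0$ is not in the $\mathfrak{p}$-adic filled Julia set of $f$, i.e. for some extension $|\cdot|$ of $|\cdot|_{\mathfrak{p}}$ to an absolute value on $\overline{K}$, the forward orbit $P_0, f(P_0), f(f(P_0)),\dots$ is unbounded with respect to $|\cdot|$. (If $P_0\in K$, this does not depend on the choice of the extension.) Then for all sufficiently large $n$ we have $K(P_n)\subseteq K(P_{n+1})$ and $[K(P_{n+1}):K(P_n)]=d$. -/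

import Mathlib

open Polynomial
open scoped NumberField IntermediateField

/-- The filled Julia set of the polynomial `g` with respect to the absolute value `w`: the set of
all `z` whose forward orbit under `g` is bounded. -/
def filledJuliaSet {L : Type*} [Field L] (w : AbsoluteValue L ℝ) (g : L[X]) : Set L :=
  {z | ∃ C : ℝ, ∀ N : ℕ, w ((fun x => g.eval x)^[N] z) ≤ C}

/-- Good reduction of a monic polynomial at a prime `v` of a number field: all coefficients have
`v`-adic absolute value at most one. -/
def MonicHasGoodReduction {K : Type*} [Field K] [NumberField K]
    (v : IsDedekindDomain.HeightOneSpectrum (𝓞 K)) (f : K[X]) : Prop :=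
  ∀ i : ℕ, NumberField.HeightOneSpectrum.adicAbv K v (f.coeff i) ≤ 1

/-! Good reduction preserves the closed unit disc, so escape forces |P_0| > 1. Outside the disc
|f(z)| = |z|^d, hence |P_n|^(d^n) = |P_0|. Some power |P_n|^k with 0 < k ≤ [K(P_n):K] is a value of
K exceeding 1, so it is at least q, the norm of the prime. Thus [K(P_n):K] ≥ (log q / log |P_0|)
d^n. Each step has degree at most d, and infinitely many smaller steps would violate this bound
(`eventually_eq_of_mul_pow_le`). -/

namespace AbsoluteValue

/-- An absolute value on a field that is at most `1` on the naturals is nonarchimedean. -/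
theorem isNonarchimedean_of_natCast_le_one {L : Type*} [Field L] (w : AbsoluteValue L ℝ)
    (h : ∀ n : ℕ, w n ≤ 1) : IsNonarchimedean w := by
  have : IsUltrametricDist (WithAbs w) :=
    IsUltrametricDist.isUltrametricDist_of_forall_norm_natCast_le_one fun n => by
      exact h n
  intro a b
  simpa [WithAbs.norm_eq_apply_ofAbs] using
    IsUltrametricDist.norm_add_le_max (WithAbs.toAbs w a) (WithAbs.toAbs w b)

variable {L : Type*} [Field L] {w : AbsoluteValue L ℝ}

/-- Forward, this confines orbits to the unit disc; contrapositively, it keeps preimages of outside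
points outside. -/
theorem eval_le_one_of_le_one (hw : IsNonarchimedean w) {g : L[X]} (hg : ∀ i, w (g.coeff i) ≤ 1)
    {z : L} (hz : w z ≤ 1) : w (g.eval z) ≤ 1 := by
  rw [eval_eq_sum_range]
  obtain ⟨i, -, hi⟩ := hw.finset_image_add_of_nonempty (fun i => g.coeff i * z ^ i)
    (Finset.nonempty_range_add_one (n := g.natDegree))
  refine hi.trans ?_
  rw [map_mul, map_pow]
  exact mul_le_one₀ (hg i) (by positivity) (pow_le_one₀ (by positivity) hz)

/-- Outside the unit disc, a monic polynomial with integral coefficients has the size of its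
leading term. -/
theorem eval_eq_pow_of_one_lt (hw : IsNonarchimedean w) {g : L[X]} (hm : g.Monic)
    (hg : ∀ i, w (g.coeff i) ≤ 1) {z : L} (hz : 1 < w z) :
    w (g.eval z) = w z ^ g.natDegree := by
  rw [eval_eq_sum_range, hw.apply_sum_eq_of_lt (fun a => (w.map_neg a).symm)
    (k := g.natDegree) (by simp)]
  · simp [hm.coeff_natDegree]
  · intro j hj hne
    have hlt : j < g.natDegree := by
      rw [Finset.mem_range] at hj
      omega
    simp only [map_mul, map_pow, hm.coeff_natDegree, one_mul]
    calc w (g.coeff j) * w z ^ j ≤ 1 * w z ^ j := by gcongr; exact hg j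
      _ < w z ^ g.natDegree := by rw [one_mul]; exact pow_lt_pow_right₀ hz hlt

/-- A vanishing sum with a nonzero term has two nonzero terms of equal absolute value. -/
theorem exists_ne_eq_of_sum_eq_zero (hw : IsNonarchimedean w) {ι : Type*} {s : Finset ι}
    {l : ι → L} (hs : ∑ i ∈ s, l i = 0) (hne : ∃ i ∈ s, l i ≠ 0) :
    ∃ i ∈ s, ∃ j ∈ s, i ≠ j ∧ w (l i) = w (l j) ∧ l i ≠ 0 := by
  obtain ⟨a, ha, ha0⟩ := hne
  -- A unique term of maximal size would give the sum its own nonzero size.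
  obtain ⟨k, hk, hmax⟩ := s.exists_max_image (fun i => w (l i)) ⟨a, ha⟩
  have hk0 : 0 < w (l k) := (w.pos ha0).trans_le (hmax a ha)
  by_contra! hcon
  have := hw.apply_sum_eq_of_lt (fun a => (w.map_neg a).symm) hk fun j hj hjk =>
    (hmax j hj).lt_of_ne fun h => w.ne_zero_iff.mp hk0.ne' (hcon k hk j hj hjk.symm h.symm)
  rw [hs, map_zero] at this
  exact hk0.ne this

/-- If `x ≠ 0` is algebraic over `K`, then some power of `w x` with exponent at most the degree of
`x` is the absolute value of an element of `K`. -/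
theorem exists_pow_eq_algebraMap {K : Type*} [Field K] [Algebra K L] (hw : IsNonarchimedean w)
    {x : L} (hx : IsIntegral K x) (hx0 : x ≠ 0) :
    ∃ k, 0 < k ∧ k ≤ (minpoly K x).natDegree ∧ ∃ c : K, w x ^ k = w (algebraMap K L c) := by
  set g := minpoly K x
  have hsum : ∑ i ∈ Finset.range (g.natDegree + 1), algebraMap K L (g.coeff i) * x ^ i = 0 := by
    rw [← minpoly.aeval K x, aeval_eq_sum_range]
    simp [Algebra.smul_def, g]
  obtain ⟨i, hi, j, hj, hij, heq, hne⟩ := exists_ne_eq_of_sum_eq_zero hw hsum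
    ⟨g.natDegree, by simp, by simp [(minpoly.monic hx).coeff_natDegree, g, hx0]⟩
  have hne' : algebraMap K L (g.coeff j) * x ^ j ≠ 0 := by
    rw [← w.ne_zero_iff, ← heq, w.ne_zero_iff]
    exact hne
  rw [Finset.mem_range] at hi hj
  wlog hlt : i < j generalizing i j
  · exact this j hj i hi hij.symm heq.symm hne' hne (by omega)
  -- Two terms of the minimal polynomial relation balance: |c_i x^i| = |c_j x^j|.
  refine ⟨j - i, by omega, by omega, g.coeff i / g.coeff j, ?_⟩
  have hwx : w x ≠ 0 := w.ne_zero hx0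
  have hc : w (algebraMap K L (g.coeff j)) ≠ 0 := w.ne_zero (left_ne_zero_of_mul hne')
  simp only [map_mul, map_pow] at heq
  rw [map_div₀, map_div₀, eq_div_iff hc]
  apply mul_right_cancel₀ (pow_ne_zero i hwx)
  rw [heq, mul_right_comm, ← pow_add, Nat.sub_add_cancel hlt.le, mul_comm]

end AbsoluteValue

namespace NumberField.HeightOneSpectrum

/-- The values of the `v`-adic absolute value exceeding `1` are at least the norm of `v`. -/
theorem absNorm_le_adicAbv_of_one_lt {K : Type*} [Field K] [NumberField K]
    (v : IsDedekindDomain.HeightOneSpectrum (𝓞 K)) {x : K} (hx : 1 < adicAbv K v x) :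
    (Ideal.absNorm v.asIdeal : ℝ) ≤ adicAbv K v x := by
  have h1 : (1 : ℝ) < Ideal.absNorm v.asIdeal := mod_cast one_lt_absNorm v
  have h0 : v.valuation K x ≠ 0 := fun h => by
    rw [adicAbv_def, h, map_zero, NNReal.coe_zero] at hx
    exact not_lt_of_ge zero_le_one hx
  rw [adicAbv_def, WithZeroMulInt.toNNReal_neg_apply _ h0, NNReal.coe_zpow,
    NNReal.coe_natCast] at hx ⊢
  have hpos := (one_lt_zpow_iff_right₀ h1).mp hx
  simpa using zpow_le_zpow_right₀ h1.le (Int.add_one_le_iff.mpr hpos)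

end NumberField.HeightOneSpectrum

/-- If each term of a sequence of naturals is `r n ≤ d` times the preceding one and the sequence
grows at least like `d ^ n`, then `r n = d` eventually. -/
theorem eventually_eq_of_mul_pow_le {N r : ℕ → ℕ} {d : ℕ} {c : ℝ} (hd : 0 < d) (hc : 0 < c)
    (hN : ∀ n, N (n + 1) = N n * r n) (hr : ∀ n, r n ≤ d) (hle : ∀ n, c * d ^ n ≤ N n) :
    ∀ᶠ n in Filter.atTop, r n = d := by
  have hd' : (0 : ℝ) < d := mod_cast hd
  -- This ratio decreases to a positive limit, so consecutive quotients `r n / d` tend to 1.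
  set a : ℕ → ℝ := fun n => N n / d ^ n
  have hca : ∀ n, c ≤ a n := fun n => (le_div_iff₀ (by positivity)).mpr (hle n)
  have hstep : ∀ n, a (n + 1) = a n * (r n / d) := fun n => by
    simp only [a, hN, Nat.cast_mul, pow_succ]
    field_simp
  have hanti : Antitone a := antitone_nat_of_succ_le fun n => by
    rw [hstep]
    refine mul_le_of_le_one_right (hc.le.trans (hca n)) ((div_le_one hd').mpr ?_)
    exact_mod_cast hr n
  have hbdd : BddBelow (Set.range a) := ⟨c, by rintro _ ⟨n, rfl⟩; exact hca n⟩
  have hlim := tendsto_atTop_ciInf hanti hbdd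
  have hpos : 0 < ⨅ n, a n := hc.trans_le (le_ciInf hca)
  have hratio := ((Filter.tendsto_add_atTop_iff_nat 1).mpr hlim).div hlim hpos.ne'
  rw [div_self hpos.ne'] at hratio
  -- Above this threshold `r n > d - 1`, and integrality gives `r n = d`.
  have hlt : 1 - 1 / (d : ℝ) < 1 := by
    have : 0 < 1 / (d : ℝ) := by positivity
    linarith
  filter_upwards [hratio.eventually_const_lt hlt] with n hn
  have han : a n ≠ 0 := (hc.trans_le (hca n)).ne'
  rw [Pi.div_apply, hstep, mul_div_cancel_left₀ _ han, lt_div_iff₀ hd', sub_mul,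
    one_div_mul_cancel hd'.ne', one_mul, sub_lt_iff_lt_add] at hn
  have : d < r n + 1 := by exact_mod_cast hn
  exact le_antisymm (hr n) (by omega)

namespace IntermediateField

theorem adjoin_simple_aeval_le {K L : Type*} [Field K] [Field L] [Algebra K L] (f : K[X]) (y : L) :
    K⟮aeval y f⟯ ≤ K⟮y⟯ :=
  adjoin_simple_le_iff.mpr (algebra_adjoin_le_adjoin K _ (aeval_mem_adjoin_singleton K y))

/-- If a monic polynomial of degree `d > 0` takes the value `x` at `y`, then
adjoining `y` to `K(x)` gives an extension of degree at most `d`. -/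
theorem relfinrank_adjoin_simple_le_natDegree {K L : Type*} [Field K] [Field L] [Algebra K L]
    {f : K[X]} (hf : f.Monic) (hd : 0 < f.natDegree) {x y : L} (h : aeval y f = x) :
    relfinrank K⟮x⟯ K⟮y⟯ ≤ f.natDegree := by
  have hle : K⟮x⟯ ≤ K⟮y⟯ := h ▸ adjoin_simple_aeval_le f y
  have hext : extendScalars hle = K⟮x⟯⟮y⟯ := by
    apply restrictScalars_injective K
    rw [extendScalars_restrictScalars, adjoin_simple_adjoin_simple]
    apply le_antisymm
    · exact adjoin.mono _ _ _ (by simp)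
    · rw [adjoin_le_iff]
      rintro z (rfl | rfl)
      · exact adjoin_simple_le_iff.mp hle
      · exact mem_adjoin_simple_self K _
  -- The polynomial f - x over K(x) vanishes at y; d > 0 keeps it monic of degree d.
  set g : K⟮x⟯[X] := f.map (algebraMap K K⟮x⟯) - C (AdjoinSimple.gen K x)
  have hdeg : (C (AdjoinSimple.gen K x)).degree < (f.map (algebraMap K K⟮x⟯)).degree := by
    rw [degree_map]
    exact degree_C_le.trans_lt (natDegree_pos_iff_degree_pos.mp hd)
  have hg : g.Monic := (hf.map _).sub_of_left hdeg
  have hroot : aeval y g = 0 := by simp [g, h]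
  have hint : IsIntegral K⟮x⟯ y := ⟨g, hg, by simpa [aeval_def] using hroot⟩
  rw [relfinrank_eq_finrank_of_le hle, hext, adjoin.finrank hint]
  refine (natDegree_le_of_dvd (minpoly.dvd _ _ hroot) hg.ne_zero).trans ?_
  simp [g]

end IntermediateField

theorem corollary3 {K : Type*} [Field K] [NumberField K] (f : K[X]) (hf : f.Monic)
    (P : ℕ → AlgebraicClosure K)
    (hP : ∀ n : ℕ, aeval (P (n + 1)) f = P n)
    (v : IsDedekindDomain.HeightOneSpectrum (𝓞 K))
    (p : ℕ) (hp : p.Prime) (hpv : (p : 𝓞 K) ∈ v.asIdeal)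
    (hpd : ¬ p ∣ f.natDegree)
    (hgood : MonicHasGoodReduction v f)
    (w : AbsoluteValue (AlgebraicClosure K) ℝ)
    (hw : w.LiesOver (NumberField.HeightOneSpectrum.adicAbv K v))
    (hP0 : P 0 ∉ filledJuliaSet w (f.map (algebraMap K (AlgebraicClosure K)))) :
    ∀ᶠ n : ℕ in Filter.atTop,
      K⟮P n⟯ ≤ K⟮P (n + 1)⟯ ∧
        IntermediateField.relfinrank K⟮P n⟯ K⟮P (n + 1)⟯ = f.natDegree := by
  have hd : 0 < f.natDegree := Nat.pos_of_ne_zero fun h => hpd (h ▸ dvd_zero p)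
  have hwK : ∀ x : K, w (algebraMap K _ x) = NumberField.HeightOneSpectrum.adicAbv K v x :=
    fun x => DFunLike.congr_fun hw.comp_eq x
  have hna : IsNonarchimedean w := w.isNonarchimedean_of_natCast_le_one fun n => by
    rw [← map_natCast (algebraMap K (AlgebraicClosure K)), hwK]
    exact NumberField.HeightOneSpectrum.adicAbv_natCast_le_one K v n
  set g := f.map (algebraMap K (AlgebraicClosure K)) with hgdef
  have hg : ∀ i, w (g.coeff i) ≤ 1 := fun i => by
    rw [hgdef, coeff_map, hwK]
    exact hgood i
  have hgm : g.Monic := hf.map _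
  have hgd : g.natDegree = f.natDegree := natDegree_map _
  have hPg : ∀ n, g.eval (P (n + 1)) = P n := fun n => by
    rw [hgdef, eval_map_algebraMap, hP]
  have hP0' : 1 < w (P 0) := by
    by_contra! hle
    refine hP0 ⟨1, fun N => ?_⟩
    induction N with
    | zero => exact hle
    | succ N ih =>
      rw [Function.iterate_succ_apply']
      exact AbsoluteValue.eval_le_one_of_le_one hna hg ih
  have hPn : ∀ n, 1 < w (P n) ∧ w (P n) ^ f.natDegree ^ n = w (P 0) := fun n => by
    induction n with
    | zero => simpa using hP0'
    | succ n ih =>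
      have hlt : 1 < w (P (n + 1)) := by
        by_contra! hle
        have := AbsoluteValue.eval_le_one_of_le_one hna hg hle
        rw [hPg] at this
        exact this.not_gt ih.1
      have := AbsoluteValue.eval_eq_pow_of_one_lt hna hgm hg hlt
      rw [hPg, hgd] at this
      refine ⟨hlt, ?_⟩
      rw [pow_succ', pow_mul, ← this, ih.2]
  have hle : ∀ n, K⟮P n⟯ ≤ K⟮P (n + 1)⟯ := fun n =>
    (congrArg (fun x => K⟮x⟯) (hP n)).ge.trans (IntermediateField.adjoin_simple_aeval_le f _)
  set q : ℝ := ((Ideal.absNorm v.asIdeal : ℕ) : ℝ)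
  have hq : 1 < q := Nat.one_lt_cast.mpr (NumberField.HeightOneSpectrum.one_lt_absNorm v)
  have hbound : ∀ n, Real.log q / Real.log (w (P 0)) * (f.natDegree : ℝ) ^ n ≤
      (Module.finrank K K⟮P n⟯ : ℝ) := fun n => by
    obtain ⟨hn1, hn⟩ := hPn n
    have hint : IsIntegral K (P n) := Algebra.IsIntegral.isIntegral _
    obtain ⟨k, hk0, hk, c, hc⟩ := AbsoluteValue.exists_pow_eq_algebraMap hna hint
      (w.ne_zero_iff.mp (zero_lt_one.trans hn1).ne')
    have hqk : q ≤ w (P n) ^ k := by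
      rw [hc, hwK]
      refine NumberField.HeightOneSpectrum.absNorm_le_adicAbv_of_one_lt v ?_
      rw [← hwK, ← hc]
      exact one_lt_pow₀ hn1 hk0.ne'
    have hlog := Real.log_le_log (zero_lt_one.trans hq) hqk
    rw [Real.log_pow] at hlog
    have hpos : 0 < Real.log (w (P n)) := Real.log_pos hn1
    -- Substituting log |P_0| = d^n log |P_n| cancels d^n and leaves log q ≤ [K(P_n):K] log |P_n|.
    rw [IntermediateField.adjoin.finrank hint, ← hn, Real.log_pow, Nat.cast_pow]
    have hd' : (0 : ℝ) < (f.natDegree : ℝ) ^ n := by positivity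
    rw [div_mul_eq_mul_div, mul_comm (Real.log q), mul_div_mul_left _ _ hd'.ne',
      div_le_iff₀ hpos]
    refine hlog.trans ?_
    gcongr
  filter_upwards [eventually_eq_of_mul_pow_le hd
    (div_pos (Real.log_pos hq) (Real.log_pos hP0'))
    (fun n => (IntermediateField.finrank_bot_mul_relfinrank (hle n)).symm)
    (fun n => IntermediateField.relfinrank_adjoin_simple_le_natDegree hf hd (hP n)) hbound]
    with n hn using ⟨hle n, hn⟩
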